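/- Let $\mathbb{A}$ be an algebra (a set $A$ with finitary basic operations) and $\mathrm{Con}(\mathbb{A})$ its lattice of congruences, with least element $0$ (equality) and greatest element $1$. A term $t$ of arity $m$ is a Taylor term for $\mathbb{A}$ if $\mathbb{A}$ satisfies $t(x,\dots,x)\approx x$ and, for every $e\in\{0,\dots,m-1\}$, an identity $$t(z_{e,0},\dots,z_{e,m-1})\approx t(w_{e,0},\dots,w_{e,m-1}),\qquad z_{e,j},w_{e,j}\in\{x,y\},\quad z_{e,e}=x,\quad w_{e,e}=y.$$ $\mathbb{A}$ is a Taylor algebra if it has a Taylor term. For $k\ge 2$ and $\theta_0,\dots,\theta_{k-1}\in\mathrm{Con}(\mathbb{A})$, consider labeled cubes $\gamma\in A^{2^k}$, indexed by the functions $f:\{0,\dots,k-1\}\to\{0,1\}$. For $R\subseteq A^{2^k}$ and $i<k$, regard $R$ as a binary relation by pairing the face $\{f_i=0\}$ of each $\gamma\in R$ with its face $\{f_i=1\}$. $R$ is a $k$-dimensional tolerance if, for each $i$, this binary relation is symmetric and quasireflexive ($(a,b)$ in the relation implies $(a,a)$ and $(b,b)$ in it), and $R$ is closed under the basic operations of $\mathbb{A}$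 applied vertexwise. Let $M(\theta_0,\dots,\theta_{k-1})$ be the least $k$-dimensional tolerance that contains, for all $i<k$ and $(x,y)\in\theta_i$, the cube with label $x$ at the vertices with $f_i=0$ and $y$ at those with $f_i=1$. For $\delta\in\mathrm{Con}(\mathbb{A})$, a set $R\subseteq A^{2^k}$ has $(\delta,i)$-centrality if there is no $\gamma\in R$ such that exactly $2^{k-1}-1$ of the $2^{k-1}$ lines of $\gamma$ in direction $i$ (pairs of labels at two vertices that differ exactly in coordinate $i$) belong to $\delta$. The $k$-ary term condition commutator is $$[\theta_0,\dots,\theta_{k-1}]_{TC}=\bigwedge\{\delta\in\mathrm{Con}(\mathbb{A}) : M(\theta_0,\dots,\theta_{k-1})\text{ has }(\delta,k-1)\text{-centrality}\},$$ and for $k=1$ the same formula gives $[\theta_0]_{TC}=\theta_0$. For $\theta\in\mathrm{Con}(\mathbb{A})$ put $(\theta]_0=\theta$ and $(\theta]_{n+1}=[\theta,(\theta]_n]_{TC}$. The congruence $\theta$ is $n$-step left nilpotent if $(\theta]_n=0$, and $n$-step supernilpotent if $[\theta,\dots,\theta]_{TC}=0$ with $n+1$ entries. It is left nilpotent (supernilpotent)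 if it is $n$-step left nilpotent ($n$-step supernilpotent) for some $n\ge 1$. The algebra $\mathbb{A}$ is nilpotent (supernilpotent) if its congruence $1$ is left nilpotent (supernilpotent). **Theorem.** Let $\mathbb{A}$ be a Taylor algebra. For every $\theta\in\mathrm{Con}(\mathbb{A})$ and every $n\ge 0$, $$(\theta]_n\le[\underbrace{\theta,\dots,\theta}_{n+1}]_{TC}.$$ Consequently every $n$-step supernilpotent congruence of $\mathbb{A}$ is $n$-step left nilpotent, every supernilpotent congruence of $\mathbb{A}$ is left nilpotent, and if $\mathbb{A}$ is supernilpotent then $\mathbb{A}$ is nilpotent. -/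

import Mathlib

universe u v w

namespace UnivAlg

open FirstOrder.Language.Structure

/-! ### Congruences

An algebra is a structure `A` for a (purely functional) language `L`; its basic operations are the
maps `funMap f`, for `f` a function symbol of `L`. -/

section Congruences

variable (L : FirstOrder.Language.{u, v}) (A : Type w) [L.Structure A]

/-- A congruence of the algebra `A`: an equivalence relation that is compatible with all basic
operations. -/
@[ext]
structure Congruence extends Setoid A where
  map_rel : ∀ {n : ℕ} (f : L.Functions n) (x y : Fin n → A),
    (∀ k, toSetoid (x k) (y k)) → toSetoid (funMap f x) (funMap f y)

namespace Congruence

variable {L A}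

/-- `δ.Rel a b` says that `⟨a, b⟩` is a `δ`-pair. -/
def Rel (δ : Congruence L A) (a b : A) : Prop := δ.toSetoid a b

/-- Congruences are ordered by inclusion. -/
instance : PartialOrder (Congruence L A) where
  le θ δ := ∀ a b, θ.Rel a b → δ.Rel a b
  le_refl _ _ _ h := h
  le_trans _ _ _ h₁ h₂ a b h := h₂ a b (h₁ a b h)
  le_antisymm _ _ h₁ h₂ := Congruence.ext (funext fun a => funext fun b =>
    propext ⟨h₁ a b, h₂ a b⟩)

/-- The meet of a set of congruences is its intersection. -/
instance : InfSet (Congruence L A) where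
  sInf D :=
    { r := fun a b => ∀ δ ∈ D, δ.Rel a b
      iseqv :=
        ⟨fun a δ _ => δ.toSetoid.refl a, fun h δ hδ => δ.toSetoid.symm (h δ hδ),
          fun h h' δ hδ => δ.toSetoid.trans (h δ hδ) (h' δ hδ)⟩
      map_rel := fun f x y h δ hδ => δ.map_rel f x y fun k => h k δ hδ }

/-- The least congruence `0`, equality. -/
instance : Bot (Congruence L A) where
  bot :=
    { r := fun a b => a = b
      iseqv := ⟨fun _ => rfl, Eq.symm, Eq.trans⟩
      map_rel := fun f _ _ h => congrArg (funMap f) (funext h) }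

/-- The greatest congruence `1`, relating all pairs. -/
instance : Top (Congruence L A) where
  top :=
    { r := fun _ _ => True
      iseqv := ⟨fun _ => trivial, fun _ => trivial, fun _ _ => trivial⟩
      map_rel := fun _ _ _ _ => trivial }

theorem isGLB_sInf (D : Set (Congruence L A)) : IsGLB D (sInf D) :=
  ⟨fun δ hδ _ _ h => h δ hδ, fun _ hθ a b h _ hδ => hθ hδ a b h⟩

/-- The congruence lattice of `A`. -/
instance : CompleteLattice (Congruence L A) where
  __ := completeLatticeOfInf (Congruence L A) isGLB_sInf
  bot := ⊥
  top := ⊤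
  bot_le θ := fun a _ h => h ▸ θ.toSetoid.refl a
  le_top _ := fun _ _ _ => trivial

end Congruence

end Congruences

/-! ### Cubes and higher dimensional tolerances -/

section Cubes

/-- Labeled cubes `γ ∈ A^(2^ι)`: every vertex `f ∈ 2^ι` is labeled by an element of `A`. -/
abbrev Cube (ι : Type*) (A : Type*) : Type _ := (ι → Fin 2) → A

variable {ι : Type*} [DecidableEq ι] {A : Type w}

/-- The vertex `f ∪ {⟨i, b⟩}` of `2^ι`, where `f ∈ 2^(ι ∖ {i})` and `b ∈ 2`. -/
def insertCoord (i : ι) (b : Fin 2) (f : {j : ι // j ≠ i} → Fin 2) : ι → Fin 2 :=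
  fun j => if h : j = i then b else f ⟨j, h⟩

/-- The face of the cube `γ` on which the `i`-th coordinate is `b`. -/
def face (i : ι) (b : Fin 2) (γ : Cube ι A) : Cube {j : ι // j ≠ i} A :=
  fun f => γ (insertCoord i b f)

/-- A set `R` of cubes, viewed as the binary relation that relates the face `i = 0` of each
`γ ∈ R` to the face `i = 1` of `γ`. -/
def facesRel (i : ι) (R : Set (Cube ι A)) (a b : Cube {j : ι // j ≠ i} A) : Prop :=
  ∃ γ ∈ R, face i 0 γ = a ∧ face i 1 γ = b

variable (L : FirstOrder.Language.{u, v}) [L.Structure A]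

/-- Higher dimensional tolerances: sets of cubes that are quasireflexive and symmetric in every
direction and compatible with the basic operations (acting vertexwise). -/
structure IsTolerance (R : Set (Cube ι A)) : Prop where
  quasirefl : ∀ (i : ι) (a b : Cube {j : ι // j ≠ i} A),
    facesRel i R a b → facesRel i R a a ∧ facesRel i R b b
  symm : ∀ (i : ι) (a b : Cube {j : ι // j ≠ i} A), facesRel i R a b → facesRel i R b a
  compatible : ∀ {n : ℕ} (f : L.Functions n) (γ : Fin n → Cube ι A),
    (∀ k, γ k ∈ R) → (fun v => funMap f fun k => γ k v) ∈ R

/-- The tolerance generated by a set of cubes. -/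
def toleranceGenerate (X : Set (Cube ι A)) : Set (Cube ι A) :=
  ⋂₀ {R | IsTolerance L R ∧ X ⊆ R}

/-- The cube with label `x` on the face `i = 0` and label `y` on the face `i = 1`. -/
def edgeCube (i : ι) (x y : A) : Cube ι A := fun f => if f i = 0 then x else y

variable {L}

/-- `M(θ)`: the algebra of `θ`-matrices. -/
def matrices (θ : ι → Congruence L A) : Set (Cube ι A) :=
  toleranceGenerate L {γ | ∃ i x y, (θ i).Rel x y ∧ γ = edgeCube i x y}

/-- `(δ, i)`-centrality of a set `R` of cubes: there is no `γ ∈ R` for which all but exactly one of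
the `2^(|ι|-1)` lines of `γ` in direction `i` are `δ`-pairs. -/
def HasCentrality (R : Set (Cube ι A)) (δ : Congruence L A) (i : ι) : Prop :=
  ¬ ∃ γ ∈ R, ∃! f : {j : ι // j ≠ i} → Fin 2,
    ¬ δ.Rel (γ (insertCoord i 0 f)) (γ (insertCoord i 1 f))

end Cubes

/-! ### The term condition commutator, nilpotence and supernilpotence -/

section Commutator

variable {L : FirstOrder.Language.{u, v}} {A : Type w} [L.Structure A]

/-- The `(n + 1)`-ary term condition commutator `[θ₀, …, θₙ]_TC`. It is meant for `n ≥ 1`; in the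
degenerate case `n = 0` it gives `[θ₀]_TC = θ₀`. -/
def tcCommutator {n : ℕ} (θ : Fin (n + 1) → Congruence L A) : Congruence L A :=
  sInf {δ | HasCentrality (matrices θ) δ (Fin.last n)}

/-- The lower central series: `(θ]_0 = θ` and `(θ]_{n+1} = [θ, (θ]_n]_TC`. -/
def lowerCentral (θ : Congruence L A) : ℕ → Congruence L A
  | 0 => θ
  | n + 1 => tcCommutator ![θ, lowerCentral θ n]

/-- `θ` is `n`-step left nilpotent. -/
def IsLeftNilpotentOfStep (θ : Congruence L A) (n : ℕ) : Prop := lowerCentral θ n = ⊥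

/-- `θ` is `n`-step supernilpotent: `[θ, …, θ]_TC = 0`, with `n + 1` entries. -/
def IsSupernilpotentOfStep (θ : Congruence L A) (n : ℕ) : Prop :=
  tcCommutator (fun _ : Fin (n + 1) => θ) = ⊥

/-- `θ` is left nilpotent. -/
def IsLeftNilpotent (θ : Congruence L A) : Prop := ∃ n, 1 ≤ n ∧ IsLeftNilpotentOfStep θ n

/-- `θ` is supernilpotent. -/
def IsSupernilpotent (θ : Congruence L A) : Prop := ∃ n, 1 ≤ n ∧ IsSupernilpotentOfStep θ n

variable (L A)

/-- The algebra `A` is nilpotent if its greatest congruence is left nilpotent. -/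
def IsNilpotentAlgebra : Prop := IsLeftNilpotent (⊤ : Congruence L A)

/-- The algebra `A` is supernilpotent if its greatest congruence is supernilpotent. -/
def IsSupernilpotentAlgebra : Prop := IsSupernilpotent (⊤ : Congruence L A)

end Commutator

/-! ### Taylor algebras -/

section Taylor

variable {L : FirstOrder.Language.{u, v}} (A : Type w) [L.Structure A]

/-- `t` is a Taylor term for `A`: it is idempotent and, for every argument place `e`, it satisfies
an identity `t(z_{e,0}, …, z_{e,m-1}) ≈ t(w_{e,0}, …, w_{e,m-1})` whose entries are variables from
`{x, y}`, with `z_{e,e} = x` and `w_{e,e} = y`. The entries `0` and `1` of the matrices `z` and `w`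
stand for the variables `x` and `y`. -/
def IsTaylorTerm {m : ℕ} (t : L.Term (Fin m)) : Prop :=
  (∀ a : A, t.realize (fun _ => a) = a) ∧
  ∃ z w : Fin m → Fin m → Fin 2, (∀ e, z e e = 0) ∧ (∀ e, w e e = 1) ∧
    ∀ (e : Fin m) (x y : A),
      t.realize (fun j => ![x, y] (z e j)) = t.realize (fun j => ![x, y] (w e j))

variable (L)

/-- A Taylor algebra: it has a Taylor term. (An identity that holds in `A` holds in the variety
generated by `A`, so this says that `A` belongs to a variety with a Taylor term.) -/
def IsTaylorAlgebra : Prop := ∃ (m : ℕ) (t : L.Term (Fin m)), IsTaylorTerm A t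

end Taylor

end UnivAlg

/-! The two sides are separated by `cornerCongruence`, which is read off from `hyperMatrices`: the
cubes generated by the θ-edges when gluing along a common face is allowed in addition to the
operations and the face maps.

The bound `lowerCentral_le_cornerCongruence` needs no Taylor term. If δ lies below the corner
congruence of one dimension, each square of M(θ, δ) blows up to a cube of the next dimension
(`cornerSquares`). Gluing turns a square whose opposite line is trivial into a corner cube
(`corner_mem_of_cornerSquares`), so M(θ, δ) is central modulo the next corner congruence.

The bound `cornerCongruence_le_tcCommutator` uses the Taylor term. Suppose M(θ, …, θ) is central
modulo δ. Zorn's lemma extends it to a maximal closed set of cubes with θ-related labels that is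
central in all directions. Adjoining suitable gluings preserves these properties
(`isCentralExtension_gluings`), so the maximal set is closed under gluing and contains
`hyperMatrices`. A corner cube has at most one nontrivial line in any given direction, and
centrality makes this line a δ-pair.

The engine is `rel_of_taylor`. The identity for argument e shows that t does not distinguish p from
q in that argument for one choice of the other arguments; centrality transfers this to any choice
from p and q. Switching the arguments one by one and using idempotence gives p δ q. -/

namespace UnivAlg

open FirstOrder.Language.Structure Function

/-! ### Tolerances as sets of cubes closed under operations and face maps -/

section ClosedSets

variable {L : FirstOrder.Language.{u, v}} {A : Type w} [L.Structure A]
variable {ι : Type*} [DecidableEq ι]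

namespace Congruence

variable (δ : Congruence L A)

theorem Rel.refl (a : A) : δ.Rel a a := δ.toSetoid.refl a

variable {δ}

theorem Rel.of_eq {a b : A} (h : a = b) : δ.Rel a b := h ▸ Rel.refl δ a

theorem Rel.symm {a b : A} (h : δ.Rel a b) : δ.Rel b a := δ.toSetoid.symm h

theorem Rel.trans {a b c : A} (h : δ.Rel a b) (h' : δ.Rel b c) : δ.Rel a c :=
  δ.toSetoid.trans h h'

theorem Rel.realize {m : ℕ} (t : L.Term (Fin m)) {x y : Fin m → A} (h : ∀ l, δ.Rel (x l) (y l)) :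
    δ.Rel (t.realize x) (t.realize y) := by
  induction t with
  | var l => exact h l
  | func f ts ih => exact δ.map_rel f _ _ ih

end Congruence

open Congruence

variable (L) in
/-- Sets of cubes that are closed under the basic operations of the algebra and under all maps of
the two faces in a given direction to one another. -/
structure IsCubeAlgebra (R : Set (Cube ι A)) : Prop where
  op : ∀ {n : ℕ} (f : L.Functions n) (γ : Fin n → Cube ι A),
    (∀ k, γ k ∈ R) → (fun v => funMap f fun k => γ k v) ∈ R
  comp : ∀ (i : ι) (σ : Fin 2 → Fin 2), ∀ γ ∈ R, (fun v => γ (update v i (σ (v i)))) ∈ R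

theorem insertCoord_restrict (i : ι) (b : Fin 2) (v : ι → Fin 2) :
    insertCoord i b (fun j : {j : ι // j ≠ i} => v j) = update v i b := by
  ext j
  by_cases h : j = i
  · subst h; simp [insertCoord]
  · simp [insertCoord, h]

theorem update_insertCoord (i : ι) (b c : Fin 2) (f : {j : ι // j ≠ i} → Fin 2) :
    update (insertCoord i b f) i c = insertCoord i c f := by
  ext j
  by_cases h : j = i
  · subst h; simp [insertCoord]
  · simp [insertCoord, h]

theorem insertCoord_self (i : ι) (b : Fin 2) (f : {j : ι // j ≠ i} → Fin 2) :
    insertCoord i b f i = b := by simp [insertCoord]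

theorem fin_two_eq (b : Fin 2) : b = 0 ∨ b = 1 := by omega

theorem eq_comp_of_face {i : ι} {γ γ' : Cube ι A} (σ : Fin 2 → Fin 2)
    (h : ∀ b, face i b γ' = face i (σ b) γ) : γ' = fun v => γ (update v i (σ (v i))) := by
  funext v
  have := congrFun (h (v i)) (fun j => v j)
  simpa only [face, insertCoord_restrict, update_eq_self] using this

theorem face_comp (i : ι) (σ : Fin 2 → Fin 2) (γ : Cube ι A) (b : Fin 2) :
    face i b (fun v => γ (update v i (σ (v i)))) = face i (σ b) γ := by
  funext f
  simp only [face, insertCoord_self, update_insertCoord]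

/-- The four self-maps of a two-element set account for all cases: the swap is symmetry, the two
constants are quasireflexivity, and the identity is harmless. -/
theorem isTolerance_iff {R : Set (Cube ι A)} : IsTolerance L R ↔ IsCubeAlgebra L R := by
  constructor
  · intro h
    refine ⟨h.compatible, fun i σ γ hγ => ?_⟩
    have hrel : facesRel i R (face i (σ 0) γ) (face i (σ 1) γ) := by
      have h01 : facesRel i R (face i 0 γ) (face i 1 γ) := ⟨γ, hγ, rfl, rfl⟩
      rcases fin_two_eq (σ 0) with h0 | h0 <;> rcases fin_two_eq (σ 1) with h1 | h1 <;>
        rw [h0, h1]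
      · exact (h.quasirefl i _ _ h01).1
      · exact h01
      · exact h.symm i _ _ h01
      · exact (h.quasirefl i _ _ h01).2
    obtain ⟨γ', hγ', e0, e1⟩ := hrel
    rw [← eq_comp_of_face (γ' := γ') σ fun b => ?_]
    · exact hγ'
    · rcases fin_two_eq b with rfl | rfl <;> assumption
  · intro h
    refine ⟨?_, ?_, h.op⟩
    · rintro i _ _ ⟨γ, hγ, rfl, rfl⟩
      exact ⟨⟨_, h.comp i (fun _ => 0) γ hγ, face_comp i (fun _ => 0) γ 0,
        face_comp i (fun _ => 0) γ 1⟩,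
        ⟨_, h.comp i (fun _ => 1) γ hγ, face_comp i (fun _ => 1) γ 0,
          face_comp i (fun _ => 1) γ 1⟩⟩
    · rintro i _ _ ⟨γ, hγ, rfl, rfl⟩
      exact ⟨_, h.comp i ![1, 0] γ hγ, face_comp .., face_comp ..⟩

/-- If the lines of `γ ∈ R` in direction `i` that avoid the vertex `v` are `δ`-pairs, then so is the
line through `v`. -/
def IsCentral (δ : Congruence L A) (R : Set (Cube ι A)) (i : ι) : Prop :=
  ∀ γ ∈ R, ∀ v : ι → Fin 2,
    (∀ x : ι → Fin 2, (∃ j, j ≠ i ∧ x j ≠ v j) → δ.Rel (γ (update x i 0)) (γ (update x i 1))) →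
    δ.Rel (γ (update v i 0)) (γ (update v i 1))

theorem hasCentrality_iff {δ : Congruence L A} {R : Set (Cube ι A)} {i : ι} :
    HasCentrality R δ i ↔ IsCentral δ R i := by
  constructor
  · intro h γ hγ v hv
    by_contra hn
    refine h ⟨γ, hγ, fun j => v j, by simpa only [insertCoord_restrict] using hn, fun f hf => ?_⟩
    by_contra hne
    obtain ⟨j, hj⟩ := Function.ne_iff.1 hne
    refine hf ?_
    have := hv (insertCoord i 0 f) ⟨j, j.2, by simpa [insertCoord, j.2] using hj⟩
    simpa only [update_insertCoord] using this
  · rintro h ⟨γ, hγ, f, hf, huniq⟩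
    refine hf ?_
    have := h γ hγ (insertCoord i 0 f) fun x ⟨j, hj, hne⟩ => ?_
    · simpa only [update_insertCoord] using this
    · by_contra hn
      have := huniq (fun j => x j) (by simpa only [insertCoord_restrict] using hn)
      refine hne ?_
      have := congrFun this ⟨j, hj⟩
      simpa [insertCoord, hj] using this

theorem IsCubeAlgebra.realize_mem {R : Set (Cube ι A)} (hR : IsCubeAlgebra L R) {m : ℕ}
    (t : L.Term (Fin m)) (γ : Fin m → Cube ι A) (h : ∀ l, γ l ∈ R) :
    (fun v => t.realize fun l => γ l v) ∈ R := by
  induction t with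
  | var l => exact h l
  | func f ts ih => exact hR.op f _ ih

theorem IsCubeAlgebra.update_mem {R : Set (Cube ι A)} (hR : IsCubeAlgebra L R) (i : ι) (b : Fin 2)
    {γ : Cube ι A} (h : γ ∈ R) : (fun v => γ (update v i b)) ∈ R :=
  hR.comp i (fun _ => b) γ h

theorem IsCubeAlgebra.piecewise_mem [Finite ι] {R : Set (Cube ι A)} (hR : IsCubeAlgebra L R)
    {γ : Cube ι A} (h : γ ∈ R) (s : Finset ι) (v : ι → Fin 2) :
    (fun x => γ (s.piecewise v x)) ∈ R := by
  induction s using Finset.induction_on with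
  | empty => simpa using h
  | insert i s hi ih =>
    convert hR.update_mem i (v i) ih using 3 with x
    ext j
    by_cases hj : j = i
    · subst hj; simp [hi]
    · by_cases hs : j ∈ s <;> simp [hj, hs]

end ClosedSets

/-! ### Taylor identities and centrality -/

section Centrality

open Congruence

variable {L : FirstOrder.Language.{u, v}} {A : Type w} [L.Structure A]
variable {ι : Type*} [DecidableEq ι]

/-- Two cubes of `R` that agree modulo `δ`, except at one vertex, cannot be distinguished by the
argument `e` of a term with an identity `t(z) ≈ t(w)` in which `z e` and `w e` are different
variables. -/
theorem toggle_of_identity {δ : Congruence L A} {R : Set (Cube ι A)} (hR : IsCubeAlgebra L R)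
    {i : ι} (hc : IsCentral δ R i) {m : ℕ} {t : L.Term (Fin m)} {z w : Fin m → Fin 2} {e : Fin m}
    (hz : z e = 0) (hw : w e = 1)
    (ht : ∀ x y : A, t.realize (fun l => ![x, y] (z l)) = t.realize fun l => ![x, y] (w l))
    {α β : Cube ι A} (hα : α ∈ R) (hβ : β ∈ R) {v : ι → Fin 2}
    (h₁ : ∀ x, δ.Rel (α (update x i 1)) (β (update x i 1)))
    (h₀ : ∀ x : ι → Fin 2, (∃ j, j ≠ i ∧ x j ≠ v j) →
      δ.Rel (α (update x i 0)) (β (update x i 0))) :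
    δ.Rel (t.realize (update (fun l => α (update v i (z l))) e (α (update v i 0))))
      (t.realize (update (fun l => α (update v i (z l))) e (β (update v i 0)))) := by
  -- By the identity, `T α` has equal faces in direction `i`. Putting `β` for `α` in argument `e`
  -- changes it modulo `δ` at most at the vertex `update v i 0`, so centrality makes the line of `T
  -- β` through `v` trivial.
  let T : Cube ι A → Cube ι A := fun c x =>
    t.realize fun l => update (fun l x => α (update x i (![z l, w l] (x i)))) e c l x
  have hT : ∀ c ∈ R, T c ∈ R := fun c hcR => hR.realize_mem t _ fun l => by
    by_cases hl : l = e
    · subst hl; simpa using hcR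
    · simpa [hl] using hR.comp i ![z l, w l] α hα
  have hcongr : ∀ c c' x, δ.Rel (c x) (c' x) → δ.Rel (T c x) (T c' x) := fun c c' x h =>
    Rel.realize t fun l => by
      by_cases hl : l = e
      · subst hl; simpa using h
      · simpa [hl] using Rel.refl δ _
  have hα0 : ∀ x, T α (update x i 0) = t.realize fun l => α (update x i (z l)) := fun x => by
    refine congrArg t.realize (funext fun l => ?_)
    by_cases hl : l = e
    · subst hl; simp [hz]
    · simp [hl]
  have hα1 : ∀ x, T α (update x i 1) = t.realize fun l => α (update x i (w l)) := fun x => by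
    refine congrArg t.realize (funext fun l => ?_)
    by_cases hl : l = e
    · subst hl; simp [hw]
    · simp [hl]
  have hα01 : ∀ x, T α (update x i 0) = T α (update x i 1) := fun x => by
    have key : ∀ b, α (update x i b) = ![α (update x i 0), α (update x i 1)] b := fun b => by
      rcases fin_two_eq b with rfl | rfl <;> rfl
    rw [hα0, hα1]
    simp only [key (z _), key (w _)]
    exact ht _ _
  have hline : ∀ x, δ.Rel (α (update x i 0)) (β (update x i 0)) →
      δ.Rel (T β (update x i 0)) (T β (update x i 1)) := fun x h =>
    ((hcongr β α _ h.symm).trans (Rel.of_eq (hα01 x))).trans (hcongr α β _ (h₁ x))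
  have htop := hc (T β) (hT β hβ) v fun x hx => hline x (h₀ x hx)
  have := ((Rel.of_eq (hα01 v)).trans (hcongr α β _ (h₁ v))).trans htop.symm
  convert this using 1
  · rw [hα0]
    refine congrArg t.realize (funext fun l => ?_)
    by_cases hl : l = e
    · subst hl; simp [hz]
    · simp [hl]
  · refine congrArg t.realize (funext fun l => ?_)
    by_cases hl : l = e
    · subst hl; simp
    · simp [hl]

/-- If the argument `e` of a term does not distinguish the ends of the only line of `σ` that may be
nontrivial, for some values of the other arguments, then it does not for any values. -/
theorem toggle_of_toggle {θ δ : Congruence L A} {R : Set (Cube ι A)} (hR : IsCubeAlgebra L R)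
    {i d : ι} (hdi : d ≠ i) (hc : IsCentral δ R i)
    (hedge : ∀ x y, θ.Rel x y → edgeCube d x y ∈ R)
    {m : ℕ} {t : L.Term (Fin m)} {e : Fin m} {σ : Cube ι A} (hσ : σ ∈ R)
    (hd : ∀ x b, σ (update x d b) = σ x) {v : ι → Fin 2}
    (htriv : ∀ x : ι → Fin 2, (∃ j, j ≠ i ∧ j ≠ d ∧ x j ≠ v j) →
      δ.Rel (σ (update x i 0)) (σ (update x i 1)))
    {u y : Fin m → A} (huy : ∀ l, θ.Rel (u l) (y l))
    (h : δ.Rel (t.realize (update u e (σ (update v i 0))))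
      (t.realize (update u e (σ (update v i 1))))) :
    δ.Rel (t.realize (update y e (σ (update v i 0))))
      (t.realize (update y e (σ (update v i 1)))) := by
  -- The arguments other than `e` are edges in direction `d`, with `y` on the side of `v` and `u` on
  -- the opposite side. The line opposite to the one through `v` is then the hypothesis `h`; all
  -- others are trivial because `σ` is.
  let G : Cube ι A := fun x => t.realize fun l =>
    update (fun l (x : ι → Fin 2) => if x d = v d then y l else u l) e σ l x
  have hG : G ∈ R := hR.realize_mem t _ fun l => by
    by_cases hl : l = e
    · subst hl; simpa using hσ
    · rw [update_of_ne hl]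
      rcases fin_two_eq (v d) with hv | hv
      · convert hedge _ _ (huy l).symm using 1
        ext x; simp [edgeCube, hv]
      · convert hedge _ _ (huy l) using 1
        ext x
        rcases fin_two_eq (x d) with hx | hx <;> simp [edgeCube, hv, hx]
  have hval : ∀ x, G x = t.realize (update (if x d = v d then y else u) e (σ x)) := fun x => by
    refine congrArg t.realize (funext fun l => ?_)
    by_cases hl : l = e
    · subst hl; simp
    · simp only [update_of_ne hl]; split_ifs <;> rfl
  have hupd : ∀ (x : ι → Fin 2) b, (update x i b) d = x d := fun x b => update_of_ne hdi _ _
  have := hc G hG v fun x ⟨j, hj, hne⟩ => ?_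
  · simpa only [hval, hupd, if_true] using this
  · simp only [hval, hupd]
    by_cases hex : ∃ j, j ≠ i ∧ j ≠ d ∧ x j ≠ v j
    · refine Rel.realize t fun l => ?_
      by_cases hl : l = e
      · subst hl; simpa using htriv x hex
      · simpa [hl] using Rel.refl δ _
    · push Not at hex
      have hjd : j = d := by
        by_contra hjd
        exact hne (hex j hj hjd)
      subst hjd
      have hx : ∀ b, σ (update x i b) = σ (update v i b) := fun b => by
        rw [← hd (update v i b) (x j)]
        congr 1
        ext l
        by_cases h1 : l = j
        · subst h1; simp [hdi]
        · by_cases h2 : l = i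
          · subst h2; simp [h1]
          · simp [h1, h2, hex l h2 h1]
      rw [if_neg hne, hx, hx]
      exact h

/-- Idempotence writes `p` and `q` as values of `t` at constant tuples, and the arguments are
switched from `p` to `q` one at a time. -/
theorem rel_of_forall_toggle {δ : Congruence L A} {m : ℕ} {t : L.Term (Fin m)}
    (hid : ∀ a : A, t.realize (fun _ => a) = a) {p q : A}
    (h : ∀ e (y : Fin m → A), (∀ l, y l = p ∨ y l = q) →
      δ.Rel (t.realize (update y e p)) (t.realize (update y e q))) : δ.Rel p q := by
  have key : ∀ s : Finset (Fin m),
      δ.Rel (t.realize fun _ => p) (t.realize (s.piecewise (fun _ => q) fun _ => p)) := by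
    intro s
    induction s using Finset.induction_on with
    | empty => simpa using Rel.refl δ _
    | insert e s he ih =>
      refine ih.trans ?_
      have := h e (s.piecewise (fun _ => q) fun _ => p) fun l => by
        by_cases hl : l ∈ s <;> simp [hl]
      rw [Finset.piecewise_insert]
      rwa [update_eq_self_iff.2 (by simp [he])] at this
  have := key Finset.univ
  rwa [Finset.piecewise_univ, hid, hid] at this

/-- The combination of `toggle_of_identity` and `toggle_of_toggle` for a Taylor term. -/
theorem rel_of_taylor {θ δ : Congruence L A} (hA : IsTaylorAlgebra L A)
    {R S : Set (Cube ι A)} (hR : IsCubeAlgebra L R) (hS : IsCubeAlgebra L S) {i j d : ι}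
    (hdj : d ≠ j) (hcR : IsCentral δ R i) (hcS : IsCentral δ S j)
    (hedge : ∀ x y, θ.Rel x y → edgeCube d x y ∈ S)
    {α β : Cube ι A} (hα : α ∈ R) (hβ : β ∈ R) {x₀ : ι → Fin 2}
    (h₁ : ∀ x, δ.Rel (α (update x i 1)) (β (update x i 1)))
    (h₀ : ∀ x : ι → Fin 2, (∃ j, j ≠ i ∧ x j ≠ x₀ j) →
      δ.Rel (α (update x i 0)) (β (update x i 0)))
    (hαθ : ∀ x y, θ.Rel (α x) (α y))
    {σ : Cube ι A} (hσ : σ ∈ S) (hσθ : ∀ x y, θ.Rel (σ x) (σ y))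
    (hd : ∀ x b, σ (update x d b) = σ x) {v : ι → Fin 2}
    (htriv : ∀ x : ι → Fin 2, (∃ l, l ≠ j ∧ l ≠ d ∧ x l ≠ v l) →
      δ.Rel (σ (update x j 0)) (σ (update x j 1)))
    (hp : σ (update v j 0) = α (update x₀ i 0)) (hq : σ (update v j 1) = β (update x₀ i 0)) :
    δ.Rel (σ (update v j 0)) (σ (update v j 1)) := by
  obtain ⟨m, t, hid, z, w, hz, hw, ht⟩ := hA
  refine rel_of_forall_toggle hid fun e y hy => ?_
  have := toggle_of_identity hR hcR (hz e) (hw e) (ht e) hα hβ h₁ h₀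
  rw [← hp, ← hq] at this
  refine toggle_of_toggle hS hdj hcS hedge hσ hd htriv (fun l => ?_) this
  have hl : θ.Rel (α (update x₀ i (z e l))) (σ (update v j 0)) := by
    rw [hp]; exact hαθ _ _
  rcases hy l with h | h <;> rw [h]
  · exact hl
  · exact hl.trans (hσθ _ _)

/-! ### Gluing cubes and maximal central extensions -/

/-- The cube `γ` arises from `γ₀` and `γ₁` by gluing the face `i = 1` of `γ₀` to the face `i = 0`
of `γ₁`. -/
structure IsGluing (i : ι) (γ₀ γ₁ γ : Cube ι A) : Prop where
  left : ∀ x, γ (update x i 0) = γ₀ (update x i 0)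
  right : ∀ x, γ (update x i 1) = γ₁ (update x i 1)
  middle : ∀ x, γ₀ (update x i 1) = γ₁ (update x i 0)

theorem IsGluing.comp {i j : ι} (hij : j ≠ i) {γ₀ γ₁ γ : Cube ι A} (h : IsGluing i γ₀ γ₁ γ)
    (σ : Fin 2 → Fin 2) :
    IsGluing i (fun x => γ₀ (update x j (σ (x j)))) (fun x => γ₁ (update x j (σ (x j))))
      fun x => γ (update x j (σ (x j))) := by
  constructor <;> intro x <;> simp only [update_of_ne hij, update_comm hij.symm]
  · exact h.left _
  · exact h.right _
  · exact h.middle _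

theorem IsGluing.flip {i : ι} {γ₀ γ₁ γ : Cube ι A} (h : IsGluing i γ₀ γ₁ γ) :
    IsGluing i (fun x => γ₁ (update x i (![1, 0] (x i)))) (fun x => γ₀ (update x i (![1, 0] (x i))))
      fun x => γ (update x i (![1, 0] (x i))) := by
  constructor <;> intro x <;> simp
  · exact h.right _
  · exact h.left _
  · exact (h.middle _).symm

theorem IsGluing.of_degenerate {i : ι} (γ : Cube ι A) :
    IsGluing i γ (fun x => γ (update x i 1)) γ := by
  constructor <;> intro x <;> simp

theorem IsGluing.update_mem {i : ι} {γ₀ γ₁ γ : Cube ι A} {R : Set (Cube ι A)}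
    (hR : IsCubeAlgebra L R) (h : IsGluing i γ₀ γ₁ γ) (h₀ : γ₀ ∈ R) (h₁ : γ₁ ∈ R) (b : Fin 2) :
    (fun x => γ (update x i b)) ∈ R := by
  rcases fin_two_eq b with rfl | rfl
  · simpa only [h.left] using hR.update_mem i 0 h₀
  · simpa only [h.right] using hR.update_mem i 1 h₁

/-- The gluings in direction `i` of cubes in `R` whose faces in direction `d` are, as degenerate
cubes, in `R`. -/
def gluings (R : Set (Cube ι A)) (i d : ι) : Set (Cube ι A) :=
  {γ | (∃ γ₀ ∈ R, ∃ γ₁ ∈ R, IsGluing i γ₀ γ₁ γ) ∧ ∀ b, (fun x => γ (update x d b)) ∈ R}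

/-- The closed sets of cubes of `θ`-related elements that are central in all directions. -/
structure IsCentralExtension (θ δ : Congruence L A) (R : Set (Cube ι A)) : Prop where
  alg : IsCubeAlgebra L R
  edge : ∀ i x y, θ.Rel x y → edgeCube i x y ∈ R
  rel : ∀ γ ∈ R, ∀ x y, θ.Rel (γ x) (γ y)
  central : ∀ i, IsCentral δ R i

theorem subset_gluings {R : Set (Cube ι A)} (hR : IsCubeAlgebra L R) (i d : ι) :
    R ⊆ gluings R i d := fun γ hγ =>
  ⟨⟨γ, hγ, _, hR.update_mem i 1 hγ, .of_degenerate γ⟩, fun b => hR.update_mem d b hγ⟩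

theorem isCubeAlgebra_gluings {R : Set (Cube ι A)} (hR : IsCubeAlgebra L R) {i d : ι}
    (hdi : d ≠ i) : IsCubeAlgebra L (gluings R i d) where
  op f γ h := by
    choose γ₀ h₀ γ₁ h₁ hg using fun k => (h k).1
    refine ⟨⟨_, hR.op f γ₀ h₀, _, hR.op f γ₁ h₁, ?_⟩, fun b => hR.op f _ fun k => (h k).2 b⟩
    constructor <;> intro x <;> refine congrArg (funMap f) (funext fun k => ?_)
    · exact (hg k).left x
    · exact (hg k).right x
    · exact (hg k).middle x
  comp j σ γ h := by
    obtain ⟨⟨γ₀, h₀, γ₁, h₁, hg⟩, hd⟩ := h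
    refine ⟨?_, fun b => ?_⟩
    · by_cases hji : j = i
      · subst hji
        by_cases hσ : σ 0 = σ 1
        · have hσ' : ∀ b, σ b = σ 0 := fun b => by
            rcases fin_two_eq b with rfl | rfl
            · rfl
            · exact hσ.symm
          simp only [hσ']
          exact (subset_gluings hR j d (hg.update_mem hR h₀ h₁ _)).1
        · rcases fin_two_eq (σ 0) with h0 | h0
          · have hσ' : σ = id := by
              ext b; rcases fin_two_eq b with rfl | rfl <;> simp <;> omega
            subst hσ'
            simp only [id, update_eq_self]
            exact ⟨γ₀, h₀, γ₁, h₁, hg⟩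
          · have hσ' : σ = ![1, 0] := by
              ext b; rcases fin_two_eq b with rfl | rfl <;> simp <;> omega
            subst hσ'
            exact ⟨_, hR.comp j _ γ₁ h₁, _, hR.comp j _ γ₀ h₀, hg.flip⟩
      · exact ⟨_, hR.comp j σ γ₀ h₀, _, hR.comp j σ γ₁ h₁, hg.comp hji σ⟩
    · by_cases hjd : j = d
      · subst hjd
        simpa using hd (σ b)
      · have := hR.comp j σ _ (hd b)
        simpa only [update_of_ne hjd, update_comm hjd] using this

/-- Each use of `rel_of_taylor` needs a cube of `R` that contains the critical line and is
degenerate in a spare direction. For direction `i` this is a face in direction `d`, which is why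
`gluings` asks for these faces. For `j ≠ i` it is a face in direction `i`, and the centrality in
direction `i` just established supplies the comparison of two cubes. -/
theorem isCentralExtension_gluings {θ δ : Congruence L A} (hA : IsTaylorAlgebra L A)
    {R : Set (Cube ι A)} (hR : IsCentralExtension θ δ R) {i d : ι} (hdi : d ≠ i) :
    IsCentralExtension θ δ (gluings R i d) := by
  have hK := isCubeAlgebra_gluings hR.alg hdi
  have hrel : ∀ γ ∈ gluings R i d, ∀ x y, θ.Rel (γ x) (γ y) := by
    rintro γ ⟨⟨γ₀, h₀, γ₁, h₁, hg⟩, -⟩ x y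
    have key : ∀ x, θ.Rel (γ x) (γ₀ (update x i 1)) := fun x => by
      rcases fin_two_eq (x i) with hx | hx
      · have := hg.left x
        rw [update_eq_self_iff.2 hx.symm] at this
        rw [this]; exact hR.rel _ h₀ _ _
      · have := hg.right x
        rw [update_eq_self_iff.2 hx.symm] at this
        rw [this, hg.middle]; exact hR.rel _ h₁ _ _
    exact ((key x).trans (hR.rel _ h₀ _ _)).trans (key y).symm
  have hi : IsCentral δ (gluings R i d) i := by
    rintro γ hγ v hv
    obtain ⟨⟨γ₀, h₀, γ₁, h₁, hg⟩, hd⟩ := id hγ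
    have hvd : ∀ b, update (update v i b) d (v d) = update v i b := fun b => by
      rw [update_comm hdi.symm, update_eq_self]
    -- The cubes compared are `γ₀` and the reflection of `γ₁`. They agree on the face along which
    -- they are glued; their other faces are the two faces of `γ`.
    have := rel_of_taylor (θ := θ) (δ := δ) hA hR.alg hR.alg hdi (hR.central i) (hR.central i)
      (hR.edge d) h₀ (hR.alg.comp i ![1, 0] γ₁ h₁) (x₀ := v)
      (fun x => Rel.of_eq (by simpa using hg.middle x))
      (fun x hx => by simpa [← hg.left, ← hg.right] using hv x hx)
      (hR.rel _ h₀) (hd (v d)) (fun x y => hrel γ hγ _ _) (fun x b => by simp) (v := v)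
      (fun x ⟨l, hl, hld, hne⟩ => by
        simpa only [update_comm hdi.symm] using
          hv (update x d (v d)) ⟨l, hl, by rwa [update_of_ne hld]⟩)
      (by rw [hvd, hg.left]) (by rw [hvd]; simpa using hg.right v)
    simpa only [hvd] using this
  refine ⟨hK, fun j x y h => subset_gluings hR.alg i d (hR.edge j x y h), hrel, fun j => ?_⟩
  by_cases hji : j = i
  · subst hji; exact hi
  intro γ hγ v hv
  obtain ⟨γ₀, h₀, γ₁, h₁, hg⟩ := hγ.1
  -- This reflection, if needed, moves the line through `v` to the face `i = 0`. The cubes compared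
  -- are `γ` and the degenerate cube on its face `j = 0`; modulo `δ` they can differ only at the end
  -- `j = 1` of that line.
  let τ : Fin 2 → Fin 2 := ![v i, 1 - v i]
  have hvi : ∀ b, update (update v j b) i (v i) = update v j b := fun b => by
    rw [update_comm hji, update_eq_self]
  have hline : ∀ x : ι → Fin 2, (x j = 1 → δ.Rel (γ (update x j 0)) (γ (update x j 1))) →
      δ.Rel (γ (update x j 0)) (γ x) := fun x h => by
    rcases fin_two_eq (x j) with hx | hx
    · rw [update_eq_self_iff.2 hx.symm]; exact Rel.refl δ _
    · have hx' : update x j 1 = x := update_eq_self_iff.2 hx.symm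
      simpa only [hx'] using h hx
  have := rel_of_taylor (θ := θ) (δ := δ) hA hK hR.alg (Ne.symm hji) hi (hR.central j) (hR.edge i)
    (α := fun x => γ (update (update x i (τ (x i))) j 0)) (β := fun x => γ (update x i (τ (x i))))
    (hK.comp i τ _ (hK.update_mem j 0 hγ)) (hK.comp i τ _ hγ) (x₀ := update v j 1)
    (fun x => hline _ fun hx => hv _ ⟨i, Ne.symm hji, by
      simp only [update_self, τ]
      rcases fin_two_eq (v i) with h | h <;> simp [h]⟩)
    (fun x ⟨l, hl, hne⟩ => hline _ fun hx => hv _ ⟨l, ?_, ?_⟩)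
    (fun x y => hrel γ hγ _ _) (hg.update_mem hR.alg h₀ h₁ (v i)) (fun x y => hrel γ hγ _ _)
    (fun x b => by simp) (v := v)
    (fun x ⟨l, hl, hli, hne⟩ => by
      simpa only [update_comm hji] using hv (update x i (v i)) ⟨l, hl, by rwa [update_of_ne hli]⟩)
    ?_ ?_
  · simpa only [hvi] using this
  · rintro rfl
    rw [update_self] at hne
    simp only [update_of_ne hl] at hx
    exact hne hx
  · have hlj : l ≠ j := by
      rintro rfl
      rw [update_self] at hne
      simp only [update_of_ne hl] at hx
      exact hne hx
    simpa [hl, hlj] using hne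
  · simp [τ, hvi, update_comm hji]
  · simp [τ, hvi, update_comm hji]

theorem exists_maximal_centralExtension {θ δ : Congruence L A} {R : Set (Cube ι A)}
    (hR : IsCentralExtension θ δ R) :
    ∃ S, R ⊆ S ∧ Maximal (IsCentralExtension θ δ) S := by
  refine zorn_subset_nonempty {S | IsCentralExtension θ δ S} (fun c hc hchain ⟨S₀, hS₀⟩ => ?_) R hR
  refine ⟨⋃₀ c, ⟨⟨fun f γ hγ => ?_, ?_⟩, ?_, ?_, ?_⟩, fun s hs => Set.subset_sUnion_of_mem hs⟩
  · have : ∃ S ∈ c, Set.range γ ⊆ S :=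
      hchain.directedOn.exists_mem_subset_of_finite_of_subset_sUnion ⟨S₀, hS₀⟩
        (Set.finite_range γ) (by rintro _ ⟨k, rfl⟩; exact hγ k)
    obtain ⟨S, hS, hsub⟩ := this
    exact ⟨S, hS, (hc hS).alg.op f γ fun k => hsub ⟨k, rfl⟩⟩
  · rintro i σ γ ⟨S, hS, hγ⟩
    exact ⟨S, hS, (hc hS).alg.comp i σ γ hγ⟩
  · exact fun i x y h => ⟨S₀, hS₀, (hc hS₀).edge i x y h⟩
  · rintro γ ⟨S, hS, hγ⟩
    exact (hc hS).rel γ hγ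
  · rintro i γ ⟨S, hS, hγ⟩
    exact (hc hS).central i γ hγ

/-- Maximality absorbs only gluings whose faces in some direction `d ≠ i` are already in `R`. Such
faces are gluings of cubes that no longer depend on `d`, hence the induction on the set of
coordinates that matter. -/
theorem mem_of_isGluing_of_support {θ δ : Congruence L A} (hA : IsTaylorAlgebra L A)
    {R : Set (Cube ι A)} (hR : Maximal (IsCentralExtension θ δ) R) (D : Finset ι) {i : ι}
    {γ₀ γ₁ γ : Cube ι A} (h₀ : γ₀ ∈ R) (h₁ : γ₁ ∈ R)
    (hD₀ : ∀ x y, (∀ l ∈ D, x l = y l) → γ₀ x = γ₀ y)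
    (hD₁ : ∀ x y, (∀ l ∈ D, x l = y l) → γ₁ x = γ₁ y) (hg : IsGluing i γ₀ γ₁ γ) : γ ∈ R := by
  induction D using Finset.strongInduction generalizing γ₀ γ₁ γ with
  | H D ih =>
    by_cases hex : ∃ d ∈ D, d ≠ i
    · obtain ⟨d, hd, hdi⟩ := hex
      have hsub : gluings R i d ⊆ R :=
        hR.le_of_ge (isCentralExtension_gluings hA hR.prop hdi) (subset_gluings hR.prop.alg i d)
      refine hsub ⟨⟨γ₀, h₀, γ₁, h₁, hg⟩, fun b => ?_⟩
      have hdep : ∀ x y : ι → Fin 2, (∀ l ∈ D.erase d, x l = y l) →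
          ∀ l ∈ D, update x d b l = update y d b l := fun x y h l hl => by
        by_cases hld : l = d
        · subst hld; simp
        · simpa [hld] using h l (Finset.mem_erase.2 ⟨hld, hl⟩)
      exact ih (D.erase d) (Finset.erase_ssubset hd) (hR.prop.alg.update_mem d b h₀)
        (hR.prop.alg.update_mem d b h₁) (fun x y h => hD₀ _ _ (hdep x y h))
        (fun x y h => hD₁ _ _ (hdep x y h)) (hg.comp hdi fun _ => b)
    -- Now only coordinate `i` matters, so the gluing is an edge, whose ends are θ-related through
    -- the shared face.
    · push Not at hex
      have hdep : ∀ x y : ι → Fin 2, x i = y i → ∀ l ∈ D, x l = y l := fun x y h l hl => by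
        rw [hex l hl, h]
      have : γ = edgeCube i (γ₀ fun _ => 0) (γ₁ fun _ => 1) := by
        ext x
        rcases fin_two_eq (x i) with hx | hx
        · have := hg.left x
          rw [update_eq_self_iff.2 hx.symm] at this
          rw [this]
          simpa [edgeCube, hx] using hD₀ _ _ (hdep _ _ hx)
        · have := hg.right x
          rw [update_eq_self_iff.2 hx.symm] at this
          rw [this]
          simpa [edgeCube, hx] using hD₁ _ _ (hdep _ _ hx)
      rw [this]
      refine hR.prop.edge _ _ _ ((hR.prop.rel _ h₀ _ (update (fun _ => 0) i 1)).trans ?_)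
      rw [hg.middle]
      exact hR.prop.rel _ h₁ _ _

theorem mem_of_isGluing [Finite ι] {θ δ : Congruence L A} (hA : IsTaylorAlgebra L A)
    {R : Set (Cube ι A)} (hR : Maximal (IsCentralExtension θ δ) R) {i : ι}
    {γ₀ γ₁ γ : Cube ι A} (h₀ : γ₀ ∈ R) (h₁ : γ₁ ∈ R) (hg : IsGluing i γ₀ γ₁ γ) : γ ∈ R := by
  have := Fintype.ofFinite ι
  exact mem_of_isGluing_of_support hA hR Finset.univ h₀ h₁
    (fun x y h => congrArg γ₀ (funext fun l => h l (Finset.mem_univ l)))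
    (fun x y h => congrArg γ₁ (funext fun l => h l (Finset.mem_univ l))) hg

end Centrality

/-! ### Higher dimensional congruences and their corners -/

section CubeCongruences

open Congruence

variable {L : FirstOrder.Language.{u, v}} {A : Type w} [L.Structure A]
variable {ι : Type*} [DecidableEq ι]

variable (L) in
/-- Higher dimensional congruences: closed sets of cubes that are transitive in all directions. -/
structure IsCubeCongruence (R : Set (Cube ι A)) : Prop where
  alg : IsCubeAlgebra L R
  glue : ∀ (i : ι) (γ₀ γ₁ γ : Cube ι A), γ₀ ∈ R → γ₁ ∈ R → IsGluing i γ₀ γ₁ γ → γ ∈ R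

/-- The higher dimensional congruence generated by the `θ`-edges. -/
def hyperMatrices (ι : Type*) [DecidableEq ι] (θ : Congruence L A) : Set (Cube ι A) :=
  ⋂₀ {R | IsCubeCongruence L R ∧ ∀ i x y, θ.Rel x y → edgeCube i x y ∈ R}

theorem isCubeCongruence_hyperMatrices (θ : Congruence L A) :
    IsCubeCongruence L (hyperMatrices ι θ) where
  alg :=
    { op := fun f γ h R hR => hR.1.alg.op f γ fun k => h k R hR
      comp := fun i σ γ h R hR => hR.1.alg.comp i σ γ (h R hR) }
  glue := fun i γ₀ γ₁ γ h₀ h₁ hg R hR => hR.1.glue i γ₀ γ₁ γ (h₀ R hR) (h₁ R hR) hg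

theorem edgeCube_mem_hyperMatrices {θ : Congruence L A} (i : ι) {x y : A} (h : θ.Rel x y) :
    edgeCube i x y ∈ hyperMatrices ι θ := fun _ hR => hR.2 i x y h

theorem const_mem_hyperMatrices [Nonempty ι] (θ : Congruence L A) (a : A) :
    (fun _ => a) ∈ hyperMatrices ι θ := by
  obtain ⟨i⟩ := ‹Nonempty ι›
  convert edgeCube_mem_hyperMatrices i (Rel.refl θ a) using 1
  ext x; simp [edgeCube]

theorem IsCubeCongruence.ite_mem {R : Set (Cube ι A)} (hR : IsCubeCongruence L R) (i : ι)
    (b : Fin 2) {α β : Cube ι A} (hα : α ∈ R) (hβ : β ∈ R)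
    (h : ∀ x, α (update x i (1 - b)) = β (update x i b)) :
    (fun x => if x i = b then α x else β x) ∈ R := by
  rcases fin_two_eq b with rfl | rfl
  · exact hR.glue i α β _ hα hβ ⟨fun x => by simp, fun x => by simp, h⟩
  · exact hR.glue i β α _ hβ hα ⟨fun x => by simp, fun x => by simp, fun x => (h x).symm⟩

/-- The label `γ v` of a cube in a higher dimensional congruence may be replaced by `y` if this is
possible for the constant cube. -/
theorem IsCubeCongruence.update_mem [Fintype ι] {R : Set (Cube ι A)} (hR : IsCubeCongruence L R)
    {γ : Cube ι A} (hγ : γ ∈ R) {v : ι → Fin 2} {y : A}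
    (h : update (fun _ => γ v) v y ∈ R) : update γ v y ∈ R := by
  have hmem : ∀ s : Finset ι, (fun x => γ (s.piecewise x v)) ∈ R := fun s => by
    simpa only [Finset.piecewise_compl] using hR.alg.piecewise_mem hγ sᶜ v
  -- The cube is unfolded from the constant cube one direction at a time: the half containing `v`
  -- comes from the modified cube, the other half from `γ` itself.
  have key : ∀ s : Finset ι, update (fun x => γ (s.piecewise x v)) v y ∈ R := by
    intro s
    induction s using Finset.induction_on with
    | empty => simpa using h
    | insert l s hl ih =>
      have hne : (1 : Fin 2) - v l ≠ v l := by
        rcases fin_two_eq (v l) with h | h <;> simp [h]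
      have hpw : ∀ x : ι → Fin 2, x l = v l → (insert l s).piecewise x v = s.piecewise x v :=
        fun x hx => by rw [Finset.piecewise_insert, hx, update_eq_self_iff]; simp [hl]
      have hpw' : ∀ (x : ι → Fin 2) b, s.piecewise (update x l b) v = s.piecewise x v :=
        fun x b => by
          ext j
          by_cases hj : j ∈ s
          · simp [hj, ne_of_mem_of_not_mem hj hl]
          · simp [hj]
      convert hR.ite_mem l (v l) ih (hmem (insert l s)) fun x => ?_ using 1
      · ext x
        by_cases hx : x l = v l
        · rw [if_pos hx]
          by_cases hxv : x = v
          · subst hxv; simp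
          · simp [hxv, hpw x hx]
        · rw [if_neg hx, update_of_ne fun h => hx (congrFun h l)]
      · rw [update_of_ne fun h => hne (by simpa using congrFun h l), hpw',
          hpw _ (update_self ..), hpw']
  simpa using key Finset.univ

/-- The pairs `(x, y)` for which the cubes with exactly one label `y` and all other labels `x`, or
the other way round, are in the higher dimensional congruence generated by the `θ`-edges. -/
def cornerCongruence (ι : Type*) [DecidableEq ι] [Fintype ι] [Nonempty ι] (θ : Congruence L A) :
    Congruence L A where
  r x y := ∀ v, update (fun _ => x) v y ∈ hyperMatrices ι θ ∧
    update (fun _ => y) v x ∈ hyperMatrices ι θ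
  iseqv := by
    have hΔ := isCubeCongruence_hyperMatrices (ι := ι) θ
    refine ⟨fun x v => ?_, fun h v => (h v).symm, fun {x y z} h h' v => ⟨?_, ?_⟩⟩
    · simpa [update_eq_self_iff.2] using const_mem_hyperMatrices θ x
    · simpa using hΔ.update_mem (h v).1 (v := v) (y := z) (by simpa using (h' v).1)
    · simpa using hΔ.update_mem (h' v).2 (v := v) (y := x) (by simpa using (h v).2)
  map_rel f x y h v := by
    have hΔ := isCubeCongruence_hyperMatrices (ι := ι) θ
    constructor
    · convert hΔ.alg.op f _ fun k => (h k v).1 using 1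
      ext w
      by_cases hw : w = v
      · subst hw; simp
      · simp [hw]
    · convert hΔ.alg.op f _ fun k => (h k v).2 using 1
      ext w
      by_cases hw : w = v
      · subst hw; simp
      · simp [hw]

/-- Renaming the directions of cubes along an injection preserves the generated higher dimensional
congruence. -/
theorem comp_mem_hyperMatrices {κ : Type*} [DecidableEq κ] {θ : Congruence L A} {g : ι → κ}
    (hg : Injective g) {γ : Cube ι A} (h : γ ∈ hyperMatrices ι θ) :
    (fun x : κ → Fin 2 => γ (x ∘ g)) ∈ hyperMatrices κ θ := by
  have hΔ := isCubeCongruence_hyperMatrices (ι := κ) θ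
  have hupd : ∀ (x : κ → Fin 2) i b, update x (g i) b ∘ g = update (x ∘ g) i b :=
    fun x i b => update_comp_eq_of_injective x hg i b
  refine h {γ | (fun x : κ → Fin 2 => γ (x ∘ g)) ∈ hyperMatrices κ θ} ⟨⟨⟨?_, ?_⟩, ?_⟩, ?_⟩
  · exact fun f γ hγ => hΔ.alg.op f _ hγ
  · intro i σ γ hγ
    simpa [hupd] using hΔ.alg.comp (g i) σ _ hγ
  · intro i γ₀ γ₁ γ h₀ h₁ hγ
    refine hΔ.glue (g i) _ _ _ h₀ h₁ ⟨fun x => ?_, fun x => ?_, fun x => ?_⟩ <;> simp only [hupd]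
    · exact hγ.left _
    · exact hγ.right _
    · exact hγ.middle _
  · exact fun i x y hxy => edgeCube_mem_hyperMatrices (g i) hxy

/-- The squares that give members of the higher dimensional congruence generated by the `θ`-edges,
if their direction `0` is kept and their vertices in direction `1` are blown up to a vertex of a
cube and the rest of this cube. -/
def cornerSquares (n : ℕ) (θ : Congruence L A) : Set (Cube (Fin 2) A) :=
  {s | ∀ (b : Fin 2) (v : Fin (n + 1) → Fin 2),
    (fun x : Fin (n + 2) → Fin 2 => s ![x 0, if Fin.tail x = v then b else 1 - b]) ∈
      hyperMatrices (Fin (n + 2)) θ}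

theorem update_zero_eq {n : ℕ} {x y : Fin (n + 1) → Fin 2} (h : Fin.tail x = Fin.tail y)
    (b : Fin 2) : update x 0 b = update y 0 b := by
  rw [← Fin.cons_self_tail x, ← Fin.cons_self_tail y, h, Fin.update_cons_zero, Fin.update_cons_zero]

theorem degenerate_mem_of_cornerSquares {n : ℕ} {θ : Congruence L A} {s : Cube (Fin 2) A}
    (hs : s ∈ cornerSquares n θ) (b : Fin 2) :
    (fun x : Fin (n + 2) → Fin 2 => s ![x 0, b]) ∈ hyperMatrices (Fin (n + 2)) θ := by
  have := (isCubeCongruence_hyperMatrices (ι := Fin (n + 2)) θ).alg.piecewise_mem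
    (hs b fun _ => 0) (Finset.univ.erase 0) fun _ => 0
  convert this using 2 with x
  rw [if_pos]
  · simp
  · ext j
    simp [Fin.tail, Fin.succ_ne_zero]

/-- Swapping the faces in direction `1` exchanges the two values of `b`, so quantifying over `b`
makes the condition symmetric; collapsing that direction leaves a degenerate cube. -/
theorem isCubeAlgebra_cornerSquares (n : ℕ) (θ : Congruence L A) :
    IsCubeAlgebra L (cornerSquares n θ) := by
  have hΔ := isCubeCongruence_hyperMatrices (ι := Fin (n + 2)) θ
  refine ⟨fun f γ hγ b v => hΔ.alg.op f _ fun k => hγ k b v, fun i σ s hs b v => ?_⟩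
  fin_cases i
  · convert hΔ.alg.comp 0 σ _ (hs b v) using 3 with x
    ext j
    fin_cases j <;> simp
  · have hupd : ∀ a c d : Fin 2, update ![a, c] 1 d = ![a, d] := fun a c d => by
      ext j; fin_cases j <;> simp
    simp only [Fin.mk_one, hupd, Matrix.cons_val_one, Matrix.cons_val_fin_one]
    by_cases hσ : σ b = σ (1 - b)
    · simpa only [apply_ite σ, ← hσ, ite_self] using degenerate_mem_of_cornerSquares hs (σ b)
    · have : σ (1 - b) = 1 - σ b := by omega
      simpa only [apply_ite σ, this] using hs (σ b) v

theorem edgeCube_zero_mem_cornerSquares (n : ℕ) {θ : Congruence L A} {x y : A} (h : θ.Rel x y) :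
    edgeCube 0 x y ∈ cornerSquares n θ := fun _ _ =>
  edgeCube_mem_hyperMatrices (ι := Fin (n + 2)) 0 h

theorem edgeCube_one_mem_cornerSquares {n : ℕ} {θ : Congruence L A} {x y : A}
    (h : (cornerCongruence (Fin (n + 1)) θ).Rel x y) :
    edgeCube 1 x y ∈ cornerSquares n θ := fun b v => by
  rcases fin_two_eq b with rfl | rfl
  · convert comp_mem_hyperMatrices (Fin.succ_injective (n + 1)) (h v).2 using 2 with z
    by_cases hz : Fin.tail z = v
    · have hz' : z ∘ Fin.succ = v := hz
      simp [edgeCube, hz, hz']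
    · have hz' : z ∘ Fin.succ ≠ v := hz
      simp [edgeCube, hz, hz']
  · convert comp_mem_hyperMatrices (Fin.succ_injective (n + 1)) (h v).1 using 2 with z
    by_cases hz : Fin.tail z = v
    · have hz' : z ∘ Fin.succ = v := hz
      simp [edgeCube, hz, hz']
    · have hz' : z ∘ Fin.succ ≠ v := hz
      simp [edgeCube, hz, hz']

/-- In the blown-up square, the hypothesis on the opposite line allows the face `1 - b` in direction
`0` to be made constant. Gluing a reflected degenerate cube along this face replaces it by the
constant `s ![b, 1 - c]`, and a single exceptional label remains. -/
theorem corner_mem_of_cornerSquares {n : ℕ} {θ : Congruence L A} {s : Cube (Fin 2) A}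
    (hs : s ∈ cornerSquares n θ) (b c : Fin 2)
    (h : (cornerCongruence (Fin (n + 2)) θ).Rel (s ![1 - b, 1 - c]) (s ![1 - b, c]))
    (v : Fin (n + 2) → Fin 2) :
    update (fun _ => s ![b, 1 - c]) v (s ![b, c]) ∈ hyperMatrices (Fin (n + 2)) θ := by
  have hΔ := isCubeCongruence_hyperMatrices (ι := Fin (n + 2)) θ
  have hb : (1 : Fin 2) - b ≠ b := by rcases fin_two_eq b with rfl | rfl <;> simp
  have hb' : ∀ a : Fin 2, a ≠ b → a = 1 - b := by omega
  have hbb : (1 : Fin 2) - (1 - b) = b := by omega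
  -- the vertex opposite to the corner is corrected first
  have h₁ := hΔ.update_mem (hs c (Fin.tail v)) (v := update v 0 (1 - b)) (y := s ![1 - b, 1 - c])
    (by simpa [Fin.tail_update_zero] using (h (update v 0 (1 - b))).2)
  have h₂ := hΔ.alg.comp 0 (fun a => 1 - a) _ (degenerate_mem_of_cornerSquares hs (1 - c))
  have h₃ := hΔ.ite_mem 0 b h₁ h₂ fun x => by
    by_cases hx : Fin.tail x = Fin.tail v
    · simp [update_zero_eq hx]
    · rw [update_of_ne fun h => hx (by simpa [Fin.tail_update_zero] using congrArg Fin.tail h)]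
      simp [hx]
  have h₄ : update (fun _ => s ![b, 1 - c]) (update v 0 b) (s ![b, c]) ∈
      hyperMatrices (Fin (n + 2)) θ := by
    convert h₃ using 1
    ext x
    by_cases hx0 : x 0 = b
    · have hne : x ≠ update v 0 (1 - b) := fun h => hb (by
        rw [h, update_self] at hx0; exact hx0)
      by_cases hx : Fin.tail x = Fin.tail v
      · have : x = update v 0 b := by
          rw [← update_zero_eq hx, update_eq_self_iff.2 hx0.symm]
        rw [if_pos hx0, update_of_ne hne, if_pos hx, hx0, this, update_self]
      · rw [if_pos hx0, update_of_ne hne, if_neg hx, hx0,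
          update_of_ne fun h => hx (by rw [h, Fin.tail_update_zero])]
    · rw [if_neg hx0, update_of_ne fun h => hx0 (by rw [h, update_self])]
      simp [hb' _ hx0, hbb]
  -- The exceptional label sits at `update v 0 b`; a reflection in direction `0` moves it to `v` if
  -- necessary.
  by_cases hv : v 0 = b
  · have hv' : update v 0 b = v := update_eq_self_iff.2 hv.symm
    rwa [hv'] at h₄
  · convert hΔ.alg.comp 0 (fun a => 1 - a) _ h₄ using 1
    ext x
    by_cases hx : x = v
    · subst hx; simp [hb' _ hv, hbb]
    · rw [update_of_ne hx, update_of_ne]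
      intro h
      refine hx (funext fun j => ?_)
      have := congrFun h j
      by_cases hj : j = 0
      · subst hj
        simp only [update_self] at this
        omega
      · simpa [hj] using this

theorem matrices_subset {θ : ι → Congruence L A} {R : Set (Cube ι A)} (hR : IsCubeAlgebra L R)
    (h : ∀ i x y, (θ i).Rel x y → edgeCube i x y ∈ R) : matrices θ ⊆ R :=
  Set.sInter_subset_of_mem ⟨isTolerance_iff.2 hR, by rintro _ ⟨i, x, y, hxy, rfl⟩; exact h i x y hxy⟩

theorem tcCommutator_le_cornerCongruence {n : ℕ} {θ δ : Congruence L A}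
    (h : δ ≤ cornerCongruence (Fin (n + 1)) θ) :
    tcCommutator ![θ, δ] ≤ cornerCongruence (Fin (n + 2)) θ := by
  have hsub : matrices ![θ, δ] ⊆ cornerSquares n θ := by
    refine matrices_subset (isCubeAlgebra_cornerSquares n θ) fun i x y hxy => ?_
    fin_cases i
    · exact edgeCube_zero_mem_cornerSquares n hxy
    · exact edgeCube_one_mem_cornerSquares (h x y hxy)
  refine (Congruence.isGLB_sInf _).1 (hasCentrality_iff.2 fun s hs v hv => ?_)
  have hupd : ∀ (x : Fin 2 → Fin 2) c, update x (Fin.last 1) c = ![x 0, c] := fun x c => by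
    ext j; fin_cases j <;> simp [Fin.last]
  simp only [hupd] at hv ⊢
  have hline := hv ![1 - v 0, 0] ⟨0, by decide, by
    simp only [Matrix.cons_val_zero]
    rcases fin_two_eq (v 0) with h | h <;> simp [h]⟩
  exact fun w => ⟨corner_mem_of_cornerSquares (hsub hs) (v 0) 1 hline w,
    corner_mem_of_cornerSquares (hsub hs) (v 0) 0 hline.symm w⟩

theorem lowerCentral_le_cornerCongruence (θ : Congruence L A) (n : ℕ) :
    lowerCentral θ n ≤ cornerCongruence (Fin (n + 1)) θ := by
  induction n with
  | zero =>
    have key : ∀ {x y : A} (v : Fin 1 → Fin 2), θ.Rel x y →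
        update (fun _ => x) v y ∈ hyperMatrices (Fin 1) θ := fun {x y} v h => by
      have hv : ∀ z : Fin 1 → Fin 2, z = v ↔ z 0 = v 0 := fun z => by
        rw [funext_iff, Fin.forall_fin_one]
      rcases fin_two_eq (v 0) with h0 | h0
      · convert edgeCube_mem_hyperMatrices (0 : Fin 1) h.symm using 1
        ext z
        by_cases hz : z 0 = 0 <;> simp [update_apply, edgeCube, hv, h0, hz]
      · convert edgeCube_mem_hyperMatrices (0 : Fin 1) h using 1
        ext z
        rcases fin_two_eq (z 0) with hz | hz <;> simp [update_apply, edgeCube, hv, h0, hz]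
    exact fun x y h v => ⟨key v h, key v h.symm⟩
  | succ n ih => exact tcCommutator_le_cornerCongruence ih

end CubeCongruences

/-! ### Comparison with the term condition commutator -/

section Comparison

open Congruence

variable {L : FirstOrder.Language.{u, v}} {A : Type w} [L.Structure A]
variable {ι : Type*} [DecidableEq ι]

theorem isCubeAlgebra_matrices (θ : ι → Congruence L A) : IsCubeAlgebra L (matrices θ) where
  op f γ h R hR := (isTolerance_iff.1 hR.1).op f γ fun k => h k R hR
  comp i σ γ h R hR := (isTolerance_iff.1 hR.1).comp i σ γ (h R hR)

theorem edgeCube_mem_matrices {θ : ι → Congruence L A} {i : ι} {x y : A} (h : (θ i).Rel x y) :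
    edgeCube i x y ∈ matrices θ := fun _ hR => hR.2 ⟨i, x, y, h, rfl⟩

theorem rel_of_mem_matrices {θ : Congruence L A} {γ : Cube ι A}
    (h : γ ∈ matrices fun _ : ι => θ) (x y : ι → Fin 2) : θ.Rel (γ x) (γ y) := by
  refine matrices_subset (R := {γ | ∀ x y, θ.Rel (γ x) (γ y)})
    ⟨fun f γ hγ x y => θ.map_rel f _ _ fun k => hγ k x y, fun i σ γ hγ x y => hγ _ _⟩
    (fun i a b hab x y => ?_) h x y
  simp only [edgeCube]
  split_ifs
  exacts [Rel.refl θ _, hab, hab.symm, Rel.refl θ _]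

theorem comp_equiv_mem_matrices {θ : Congruence L A} (g : Equiv.Perm ι) {γ : Cube ι A}
    (h : γ ∈ matrices fun _ : ι => θ) : (fun x => γ (x ∘ g)) ∈ matrices fun _ : ι => θ := by
  have hM := isCubeAlgebra_matrices fun _ : ι => θ
  refine matrices_subset (R := {γ | (fun x => γ (x ∘ g)) ∈ matrices fun _ : ι => θ})
    ⟨fun f γ hγ => hM.op f _ hγ, fun i σ γ hγ => ?_⟩ (fun i a b hab => ?_) h
  · simpa [update_comp_eq_of_injective _ g.injective] using hM.comp (g i) σ _ hγ
  · exact edgeCube_mem_matrices (i := g i) hab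

/-- All entries are the same θ, so permuting the directions preserves the matrices and carries
centrality from one direction to any other. -/
theorem isCentral_matrices {θ δ : Congruence L A} {i : ι}
    (h : IsCentral δ (matrices fun _ : ι => θ) i) (j : ι) :
    IsCentral δ (matrices fun _ : ι => θ) j := by
  intro γ hγ v hv
  let g := Equiv.swap i j
  have hupd : ∀ (x : ι → Fin 2) b, update x i b ∘ g = update (x ∘ g) j b := fun x b => by
    rw [← update_comp_eq_of_injective x g.injective]; simp [g]
  have := h _ (comp_equiv_mem_matrices g hγ) (v ∘ g) fun x ⟨l, hl, hne⟩ => by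
    simp only [hupd]
    refine hv (x ∘ g) ⟨g l, fun h => hl (g.injective ?_), ?_⟩
    · simpa [g] using h
    · simpa [g] using hne
  simp only [hupd] at this
  have hgg : (v ∘ g) ∘ g = v := by ext; simp [g]
  rwa [hgg] at this

theorem cornerCongruence_le_tcCommutator (hA : IsTaylorAlgebra L A) (θ : Congruence L A) (n : ℕ) :
    cornerCongruence (Fin (n + 1)) θ ≤ tcCommutator fun _ : Fin (n + 1) => θ := by
  intro x y hxy δ hδ
  have hM : IsCentralExtension θ δ (matrices fun _ : Fin (n + 1) => θ) :=
    ⟨isCubeAlgebra_matrices _, fun i a b h => edgeCube_mem_matrices h,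
      fun γ h => rel_of_mem_matrices h, isCentral_matrices (hasCentrality_iff.1 hδ)⟩
  obtain ⟨R, -, hR⟩ := exists_maximal_centralExtension hM
  have hsub : hyperMatrices (Fin (n + 1)) θ ⊆ R := Set.sInter_subset_of_mem
    ⟨⟨hR.prop.alg, fun i γ₀ γ₁ γ h₀ h₁ hg => mem_of_isGluing hA hR h₀ h₁ hg⟩, hR.prop.edge⟩
  have hne : ∀ w : Fin (n + 1) → Fin 2, w 0 = 0 → w ≠ fun _ => 1 := fun w h h' => by
    rw [h'] at h; exact one_ne_zero h
  -- With `y` placed at the all-ones vertex, every line in direction `0` that avoids this vertex is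
  -- constantly `x`.
  have := hR.prop.central 0 _ (hsub (hxy fun _ => 1).1) (fun _ => 1) fun z ⟨j, hj, hz⟩ => by
    rw [update_of_ne (hne _ (update_self ..)), update_of_ne]
    · exact Rel.refl δ x
    · intro h
      exact hz (by simpa [hj] using congrFun h j)
  rwa [update_of_ne (hne _ (update_self ..)), update_eq_self_iff.2 rfl, update_self] at this

theorem lowerCentral_le_tcCommutator (hA : IsTaylorAlgebra L A) (θ : Congruence L A) (n : ℕ) :
    lowerCentral θ n ≤ tcCommutator fun _ : Fin (n + 1) => θ :=
  (lowerCentral_le_cornerCongruence θ n).trans (cornerCongruence_le_tcCommutator hA θ n)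

theorem IsSupernilpotentOfStep.isLeftNilpotentOfStep (hA : IsTaylorAlgebra L A)
    {θ : Congruence L A} {n : ℕ} (h : IsSupernilpotentOfStep θ n) : IsLeftNilpotentOfStep θ n :=
  le_bot_iff.1 ((lowerCentral_le_tcCommutator hA θ n).trans h.le)

theorem IsSupernilpotent.isLeftNilpotent (hA : IsTaylorAlgebra L A) {θ : Congruence L A}
    (h : IsSupernilpotent θ) : IsLeftNilpotent θ :=
  let ⟨n, hn, hθ⟩ := h
  ⟨n, hn, hθ.isLeftNilpotentOfStep hA⟩

end Comparison

end UnivAlg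

theorem mainTheorem1 (L : FirstOrder.Language.{u, v}) [L.IsAlgebraic] (A : Type w) [L.Structure A]
    (hA : UnivAlg.IsTaylorAlgebra L A) :
    (∀ θ : UnivAlg.Congruence L A,
      (∀ n : ℕ, UnivAlg.lowerCentral θ n ≤ UnivAlg.tcCommutator (fun _ : Fin (n + 1) => θ)) ∧
      (∀ n : ℕ, UnivAlg.IsSupernilpotentOfStep θ n → UnivAlg.IsLeftNilpotentOfStep θ n) ∧
      (UnivAlg.IsSupernilpotent θ → UnivAlg.IsLeftNilpotent θ)) ∧
    (UnivAlg.IsSupernilpotentAlgebra L A → UnivAlg.IsNilpotentAlgebra L A) := by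
  exact ⟨fun θ => ⟨fun n => UnivAlg.lowerCentral_le_tcCommutator hA θ n,
    fun _ h => h.isLeftNilpotentOfStep hA, fun h => h.isLeftNilpotent hA⟩,
    fun h => UnivAlg.IsSupernilpotent.isLeftNilpotent hA h⟩
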